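/- Let $S$ be a closed topological surface with a finite cellular decomposition with sets of vertices, edges and faces $V,E,F$ (each face is a polygon with at least one side, glued along the edges; the faces on the two sides of an edge may coincide). Let $\Phi:E\to(0,\frac{\pi}{2})$ be a weight. For $\phi\in(0,\frac{\pi}{2})$ and $k_1,k_2\ge 0$ let $r_1,r_2\in(0,\frac{\pi}{2}]$ be given by $\cot r_i=k_i$, let $D_1,D_2$ be disks of radii $r_1,r_2$ in the unit sphere $\mathbb{S}^2$ whose intersection is a bigon of interior angle $\phi$, and let $\ell_1$ be the length of the side $\partial D_1\cap D_2$ of this bigon; put $L_\phi(k_1,k_2)=\ell_1k_1$, the total geodesic curvature of that side. A vector $k\in\mathbb{R}_{\ge0}^{F}$ stands for the spherical conical metric on $S$ whose circle pattern realizes $\Phi$ and whose circle at the face $f$ has geodesic curvature $k_f$ (this determines the metric with its pattern up to isometry); it is called a degenerated circle pattern metric if $k_f=0$ for some $f$. Its total geodesic curvature at $f$ is $$L_f(k)=\sum_{s}L_{\Phi(e(s))}(k_f,k_{f'(s)}),$$ where $s$ runs over the sides of the polygon $f$, $e(s)$ is the edge of $s$, and $f'(s)$ is the face on the other side of $e(s)$.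 For $\emptyset\ne I\subsetneq F$ (so $I=F_{i_1\cdots i_m}=\{i_1,\dots,i_m\}$ with $1\le m\le|F|-1$) let $\mathbb{R}^{|F|}_{I}$ be the set of $k\in\mathbb{R}^{F}$ with $k_f>0$ for $f\in I$ and $k_f=0$ for $f\notin I$, and let $$\mathcal{L}_{I}=\Big\{L\in\mathbb{R}^{|F|}_{I}\ \Big|\ \sum_{f\in F'}L_f<2\sum_{e\in E_{F'}}\Phi(e)\ \text{ for all } \emptyset\neq F'\subset I\Big\},$$ where $E_{F'}$ is the set of edges lying on the boundary of some face in $F'$. Let $\hat L\in\mathcal{L}_{I}$. Then there is a unique degenerated circle pattern metric $\hat k$ with $L_f(\hat k)=\hat L_f$ for $f\in I$ and $L_f(\hat k)=0$ for $f\in F\setminus I$, and $\hat k\in\mathbb{R}^{|F|}_{I}$. Moreover, for every initial value $\tilde k(0)\in\mathbb{R}_{>0}^{I}$ the reduced prescribed combinatorial Ricci flow $$\frac{d\tilde k_i}{dt}=-(L_i(\tilde k)-\hat L_i)\,\tilde k_i,\qquad i\in I,$$ in which $\tilde k\in\mathbb{R}_{>0}^I$ is extended by $0$ to $F\setminus I$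 when $L_i$ is evaluated, has a unique solution; it exists for all $t\in[0,\infty)$, and, extended by $0$ to $F\setminus I$, it converges to $\hat k$ as $t\to+\infty$. -/

import Mathlib

open Set Filter Topology

noncomputable section

/-! ### Cellular decompositions of a surface -/

/-- The point of parameter `t ∈ [0,1]` on the `j`-th of the `n` equal arcs (the sides of the `n`-gon)
of the unit circle. -/
def polygonArc (n : ℕ) (j : Fin n) (t : ℝ) : ℂ :=
  Complex.exp (2 * (Real.pi : ℂ) * Complex.I * (((j : ℕ) : ℂ) + (t : ℂ)) / (n : ℂ))

/-- A cellular decomposition of a closed surface `S` with sets of `0`-, `1`- and `2`-cells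
`V`, `E`, `F`. The closed `2`-cells are images of polygons (the closed unit disk whose boundary
circle is divided into `n ≥ 1` sides), every side is mapped along an edge, and every edge `e` has
two sides, indexed by `(e, false)` and `(e, true)`; the faces at the two sides of an edge, or two
sides of one polygon, are allowed to coincide, and so are the two endpoints of an edge. -/
structure CellularDecomposition (S V E F : Type*) [TopologicalSpace S] where
  /-- the `0`-cells -/
  vertex : V → S
  /-- parametrizations of the closed edges by `[0,1]` -/
  edgeMap : E → ℝ → S
  /-- parametrizations of the closed faces by the closed unit disk -/
  faceMap : F → ℂ → S
  /-- the number of sides of a face -/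
  numSides : F → ℕ
  numSides_pos : ∀ f, 0 < numSides f
  /-- the two sides of an edge are sides of polygons, and every side of a polygon arises once -/
  side : E × Bool ≃ (Σ f : F, Fin (numSides f))
  /-- whether the polygon runs along the edge against the parametrization of the edge -/
  reversed : E × Bool → Bool
  continuousOn_edge : ∀ e, ContinuousOn (edgeMap e) (Icc 0 1)
  continuousOn_face : ∀ f, ContinuousOn (faceMap f) (Metric.closedBall 0 1)
  injOn_edge : ∀ e, InjOn (edgeMap e) (Ioo 0 1)
  injOn_face : ∀ f, InjOn (faceMap f) (Metric.ball 0 1)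
  edge_zero : ∀ e, edgeMap e 0 ∈ range vertex
  edge_one : ∀ e, edgeMap e 1 ∈ range vertex
  face_boundary : ∀ s : E × Bool, ∀ t ∈ Icc (0 : ℝ) 1,
    faceMap (side s).1 (polygonArc (numSides (side s).1) (side s).2 t) =
      edgeMap s.1 (if reversed s then 1 - t else t)
  /-- `S` is the disjoint union of the vertices, the open edges and the open faces -/
  partition : ∀ x : S, ∃! c : V ⊕ E ⊕ F,
    x ∈ Sum.elim (fun v => {vertex v})
      (Sum.elim (fun e => edgeMap e '' Ioo 0 1) (fun f => faceMap f '' Metric.ball 0 1)) c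

namespace CellularDecomposition

variable {S V E F : Type*} [TopologicalSpace S]

/-- The face at a given side of an edge. -/
def face (D : CellularDecomposition S V E F) (s : E × Bool) : F := (D.side s).1

open scoped Classical in
/-- `E_{F'}`: the edges on the boundary of some face of `F'`. -/
def edgesOf [Fintype E] (D : CellularDecomposition S V E F) (F' : Finset F) : Finset E :=
  {e | ∃ f ∈ F', ∃ b : Bool, D.face (e, b) = f}

end CellularDecomposition

/-! ### Spherical bigons -/

/-- The radius `r ∈ (0, π/2]` with `cot r = k`, for `k ≥ 0`. -/
def radius (k : ℝ) : ℝ := Real.pi / 2 - Real.arctan k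

theorem cot_radius (k : ℝ) : Real.cos (radius k) / Real.sin (radius k) = k := by
  rw [radius, Real.cos_pi_div_two_sub, Real.sin_pi_div_two_sub, ← Real.tan_eq_sin_div_cos,
    Real.tan_arctan]

/-- The open disk in the unit sphere `𝕊²` with centre `p` and radius `r`; the distance of two
points of the sphere is the angle between them. -/
def sphericalDisk (p : EuclideanSpace ℝ (Fin 3)) (r : ℝ) : Set (EuclideanSpace ℝ (Fin 3)) :=
  {y | ‖y‖ = 1 ∧ InnerProductGeometry.angle p y < r}

/-- The centre of the first disk of the bigon. The bigon is placed with one corner at `(0,0,1)`;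
there the boundary circle of the first disk has inward unit normal `(1,0,0)`, and the centre is
reached from the corner in this direction along a geodesic of length `r`. -/
def centerOne (r : ℝ) : EuclideanSpace ℝ (Fin 3) :=
  Real.cos r • !₂[(0 : ℝ), 0, 1] + Real.sin r • !₂[(1 : ℝ), 0, 0]

/-- The centre of the second disk of the bigon. At the corner `(0,0,1)` its boundary circle has
inward unit normal `(-cos φ, sin φ, 0)`, which makes the angle `π - φ` with that of the first disk,
so that the interior angle of the intersection of the disks is `φ`. -/
def centerTwo (φ r : ℝ) : EuclideanSpace ℝ (Fin 3) :=
  Real.cos r • !₂[(0 : ℝ), 0, 1] + Real.sin r • !₂[-Real.cos φ, Real.sin φ, 0]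

/-- The boundary circle of the first disk, parametrized by the angle at its centre, starting at the
corner `(0,0,1)`. -/
def circleOne (r θ : ℝ) : EuclideanSpace ℝ (Fin 3) :=
  Real.cos r • centerOne r +
    Real.sin r • (Real.cos θ • !₂[-Real.cos r, 0, Real.sin r] + Real.sin θ • !₂[(0 : ℝ), 1, 0])

/-- The length of the side on the boundary of the first disk of the bigon of angle `φ` that is
formed by disks of radii `r₁` and `r₂`: the arc length of the part of the first circle that lies in
the second disk. (By reflection, the other side has length `bigonSideLength φ r₂ r₁`.) -/
def bigonSideLength (φ r₁ r₂ : ℝ) : ℝ :=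
  ∫ θ in {θ ∈ Ioc (-Real.pi) Real.pi | circleOne r₁ θ ∈ sphericalDisk (centerTwo φ r₂) r₂},
    ‖deriv (circleOne r₁) θ‖

/-- The total geodesic curvature `ℓ₁ k₁` of the side, of geodesic curvature `k₁`, of the bigon of
angle `φ` formed by disks with boundary curvatures `k₁` and `k₂`. -/
def sideCurvature (φ k₁ k₂ : ℝ) : ℝ := bigonSideLength φ (radius k₁) (radius k₂) * k₁

/-! ### Metrics, total geodesic curvatures and the flow -/

variable {S V E F : Type*} [TopologicalSpace S]

/-- The total geodesic curvature `L_f` of the face `f` for the spherical conical metric with weight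
`Φ` and geodesic curvatures `k`: the sum over the sides of `f` of the total geodesic curvature of the
corresponding side of the bigon of the edge. -/
def totalCurvature (D : CellularDecomposition S V E F) (Φ : E → ℝ) (k : F → ℝ) (f : F) : ℝ :=
  ∑ j : Fin (D.numSides f),
    sideCurvature (Φ (D.side.symm ⟨f, j⟩).1) (k f)
      (k (D.face ((D.side.symm ⟨f, j⟩).1, !(D.side.symm ⟨f, j⟩).2)))

/-- Degenerated circle pattern metrics, encoded by the geodesic curvatures of the circles. -/
def IsDegeneratedMetric (k : F → ℝ) : Prop := (∀ f, 0 ≤ k f) ∧ ∃ f, k f = 0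

/-- The vectors that are positive on the faces of `I` and zero on the others. -/
def positiveOn (I : Finset F) : Set (F → ℝ) :=
  {k | (∀ f ∈ I, 0 < k f) ∧ ∀ f ∉ I, k f = 0}

/-- The admissible prescribed total geodesic curvatures supported exactly on `I`. -/
def prescribable [Fintype E] (D : CellularDecomposition S V E F) (Φ : E → ℝ) (I : Finset F) :
    Set (F → ℝ) :=
  {L | L ∈ positiveOn I ∧ ∀ F' ⊆ I, F'.Nonempty → ∑ f ∈ F', L f < 2 * ∑ e ∈ D.edgesOf F', Φ e}

open scoped Classical in
/-- Extension by zero of curvatures given on the faces of `I`. -/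
def extendZero (I : Finset F) (k : I → ℝ) : F → ℝ :=
  fun f => if h : f ∈ I then k ⟨f, h⟩ else 0

/-- `k` solves, on the time interval `J`, the reduced prescribed combinatorial Ricci flow
`dkᵢ/dt = -(Lᵢ(k) - L̂ᵢ) kᵢ`, `i ∈ I`, in the space of positive curvatures on `I`; the curvatures
are `0` on the other faces. -/
def IsFlowSolution (D : CellularDecomposition S V E F) (Φ : E → ℝ) (I : Finset F) (Lhat : F → ℝ)
    (J : Set ℝ) (k : ℝ → I → ℝ) : Prop :=
  ∀ t ∈ J, ∀ i : I, 0 < k t i ∧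
    HasDerivWithinAt (fun s => k s i)
      (-(totalCurvature D Φ (extendZero I (k t)) i - Lhat i) * k t i) J t

end

noncomputable section

/-! ### The total geodesic curvature of a side of a bigon in closed form -/

/-! The part of the first circle inside the second disk is one arc, whose length is elementary
(`sideCurvature_eq_formula`). The closed form vanishes at `a = 0`, is positive for `a > 0`, is
nonincreasing in `b`, and increases strictly under `(a, b) ↦ (ta, tb)`, `t > 1`, when `a > 0` and `b
≥ 0`. Hence a face has zero total curvature exactly when its circle has zero curvature, so any
solution is supported on `I`. What remains is a system on positive vectors indexed by `I` that is
cooperative and increasing under scaling. Order arguments settle it, without a convex potential.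

Uniqueness: compare two solutions at the index where their ratio is largest (`le_of_eq`). Existence:
among subsolutions bounded below by a small `ε`, one with maximal coordinate sum is a solution
(`exists_eq`), provided that this set is bounded. The inequalities on `L̂` give boundedness
(`isBounded_subsolutions`): if the curvatures of the faces in `F'` tend to infinity while the others
converge, comparison with Euclidean triangles shows that every edge on the boundary of `F'`
contributes at least `2Φ(e)` in the limit, against the strict bound on `∑ L̂_f`.

In the coordinates `u = log k` the flow has a bounded `C¹` vector field, hence unique global
solutions. The same comparison, applied to the largest and smallest coordinates of `u - log k̂`,
pushes both to zero (`tendsto_of_flow`). -/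

/-- Closed form of `sideCurvature` for nonnegative curvatures. -/
def sideCurvatureFormula (φ a b : ℝ) : ℝ :=
  a / √(1 + a ^ 2) *
    (Real.pi - 2 * Real.arctan ((a * Real.cos φ + b) / (Real.sin φ * √(1 + a ^ 2))))

theorem sin_radius (k : ℝ) : Real.sin (radius k) = 1 / √(1 + k ^ 2) := by
  rw [radius, Real.sin_pi_div_two_sub, Real.cos_arctan]

theorem cos_radius (k : ℝ) : Real.cos (radius k) = k / √(1 + k ^ 2) := by
  rw [radius, Real.cos_pi_div_two_sub, Real.sin_arctan]

theorem radius_mem_Ioo (k : ℝ) : radius k ∈ Ioo 0 Real.pi := by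
  have h₁ := Real.arctan_lt_pi_div_two k
  have h₂ := Real.neg_pi_div_two_lt_arctan k
  constructor <;> unfold radius <;> linarith

theorem hasDerivAt_circleOne (r θ : ℝ) :
    HasDerivAt (circleOne r)
      (Real.sin r • (-Real.sin θ • !₂[-Real.cos r, 0, Real.sin r] +
        Real.cos θ • !₂[(0 : ℝ), 1, 0])) θ := by
  unfold circleOne
  exact ((((Real.hasDerivAt_cos θ).smul_const !₂[-Real.cos r, 0, Real.sin r]).add
    ((Real.hasDerivAt_sin θ).smul_const !₂[(0 : ℝ), 1, 0])).const_smul (Real.sin r)).const_add _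

theorem norm_deriv_circleOne {r : ℝ} (hr : 0 ≤ Real.sin r) (θ : ℝ) :
    ‖deriv (circleOne r) θ‖ = Real.sin r := by
  rw [(hasDerivAt_circleOne r θ).deriv, norm_smul, Real.norm_of_nonneg hr]
  have h : ‖-Real.sin θ • !₂[-Real.cos r, 0, Real.sin r] + Real.cos θ • !₂[(0 : ℝ), 1, 0]‖ = 1 := by
    rw [EuclideanSpace.norm_eq, Real.sqrt_eq_one]
    simp only [Fin.sum_univ_three, Real.norm_eq_abs, sq_abs]
    simp
    linear_combination Real.sin θ ^ 2 * Real.sin_sq_add_cos_sq r + Real.sin_sq_add_cos_sq θ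
  rw [h, mul_one]

theorem norm_circleOne (r θ : ℝ) : ‖circleOne r θ‖ = 1 := by
  rw [EuclideanSpace.norm_eq, Real.sqrt_eq_one]
  simp only [Fin.sum_univ_three, Real.norm_eq_abs, sq_abs, circleOne, centerOne]
  simp
  have h₁ := Real.sin_sq_add_cos_sq r
  have h₂ := Real.sin_sq_add_cos_sq θ
  have e₁ : Real.cos θ ^ 2 = 1 - Real.sin θ ^ 2 := by linarith
  have e₂ : Real.cos r ^ 2 = 1 - Real.sin r ^ 2 := by linarith
  ring_nf
  grind

theorem norm_centerTwo (φ r : ℝ) : ‖centerTwo φ r‖ = 1 := by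
  rw [EuclideanSpace.norm_eq, Real.sqrt_eq_one]
  simp only [Fin.sum_univ_three, Real.norm_eq_abs, sq_abs, centerTwo]
  simp
  linear_combination Real.sin r ^ 2 * Real.sin_sq_add_cos_sq φ + Real.sin_sq_add_cos_sq r

/-- The corner `θ = 0` lies on both circles, so the difference vanishes there. What is left is
linear in `1 - cos θ` and `sin θ`, ready for half-angle formulas. -/
theorem inner_centerTwo_circleOne (φ r₁ r₂ θ : ℝ) :
    inner ℝ (centerTwo φ r₂) (circleOne r₁ θ) - Real.cos r₂ =
      Real.sin r₁ * (Real.sin r₂ * Real.sin φ * Real.sin θ -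
        (1 - Real.cos θ) * (Real.cos r₁ * Real.sin r₂ * Real.cos φ +
          Real.cos r₂ * Real.sin r₁)) := by
  simp only [PiLp.inner_apply, Fin.sum_univ_three, circleOne, centerOne, centerTwo]
  simp
  linear_combination Real.cos r₂ * Real.sin_sq_add_cos_sq r₁

theorem circleOne_mem_sphericalDisk_iff {φ r₁ r₂ θ : ℝ} (h₁ : 0 < Real.sin r₁)
    (h₂ : r₂ ∈ Ioo 0 Real.pi) :
    circleOne r₁ θ ∈ sphericalDisk (centerTwo φ r₂) r₂ ↔
      (1 - Real.cos θ) * (Real.cos r₁ * Real.sin r₂ * Real.cos φ + Real.cos r₂ * Real.sin r₁) <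
        Real.sin r₂ * Real.sin φ * Real.sin θ := by
  have key := inner_centerTwo_circleOne φ r₁ r₂ θ
  have hangle : InnerProductGeometry.angle (centerTwo φ r₂) (circleOne r₁ θ) < r₂ ↔
      Real.cos r₂ < inner ℝ (centerTwo φ r₂) (circleOne r₁ θ) := by
    have hc := InnerProductGeometry.cos_angle (centerTwo φ r₂) (circleOne r₁ θ)
    rw [norm_centerTwo, norm_circleOne, mul_one, div_one] at hc
    rw [← hc]
    exact (Real.strictAntiOn_cos.lt_iff_gt ⟨h₂.1.le, h₂.2.le⟩
      ⟨InnerProductGeometry.angle_nonneg _ _, InnerProductGeometry.angle_le_pi _ _⟩).symm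
  simp only [sphericalDisk, mem_ofPred_eq, norm_circleOne, true_and, hangle]
  rw [← sub_pos, key, mul_pos_iff_of_pos_left h₁, sub_pos]

/-- The part of the first circle inside the second disk is the arc over `(0, θ)`,
`cot (θ / 2) = c / s`. -/
theorem one_sub_cos_mul_lt_iff {c s θ : ℝ} (hc : 0 ≤ c) (hs : 0 < s)
    (hθ : θ ∈ Ioc (-Real.pi) Real.pi) :
    (1 - Real.cos θ) * c < s * Real.sin θ ↔
      θ ∈ Ioo 0 (Real.pi - 2 * Real.arctan (c / s)) := by
  have hA : 0 ≤ Real.arctan (c / s) := Real.arctan_nonneg.2 (by positivity)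
  rcases le_or_gt θ 0 with h | h
  · have h₁ : Real.sin θ ≤ 0 := Real.sin_nonpos_of_nonpos_of_neg_pi_le h hθ.1.le
    have h₂ := Real.cos_le_one θ
    constructor
    · intro h'
      nlinarith [mul_nonneg (sub_nonneg.2 h₂) hc]
    · intro h'
      exact absurd h'.1 (not_lt.2 h)
  · have hs2 : 0 < Real.sin (θ / 2) :=
      Real.sin_pos_of_pos_of_lt_pi (by linarith) (by linarith [hθ.2])
    -- In half-angles a common factor `2 sin (θ / 2) > 0` cancels, leaving `c / s < cot (θ / 2)`.
    have e₁ : Real.sin θ = 2 * Real.sin (θ / 2) * Real.cos (θ / 2) := by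
      rw [← Real.sin_two_mul]; ring_nf
    have e₂ : 1 - Real.cos θ = 2 * Real.sin (θ / 2) ^ 2 := by
      have := Real.cos_sq (θ / 2)
      have h3 := Real.sin_sq_add_cos_sq (θ / 2)
      rw [show 2 * (θ / 2) = θ by ring] at this
      linarith
    have e₃ : Real.tan (Real.pi / 2 - θ / 2) = Real.cos (θ / 2) / Real.sin (θ / 2) := by
      rw [Real.tan_eq_sin_div_cos, Real.sin_pi_div_two_sub, Real.cos_pi_div_two_sub]
    have e₄ : c / s < Real.tan (Real.pi / 2 - θ / 2) ↔
        Real.arctan (c / s) < Real.pi / 2 - θ / 2 := by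
      conv_rhs => rw [← Real.arctan_tan (x := Real.pi / 2 - θ / 2) (by linarith [hθ.2])
        (by linarith)]
      exact Real.arctan_strictMono.lt_iff_lt.symm
    have e₅ : (1 - Real.cos θ) * c < s * Real.sin θ ↔ c / s < Real.tan (Real.pi / 2 - θ / 2) := by
      rw [e₁, e₂, e₃, div_lt_div_iff₀ hs hs2]
      constructor
      · intro h'
        nlinarith
      · intro h'
        nlinarith
    rw [e₅, e₄]
    constructor
    · intro h'
      exact ⟨h, by linarith⟩
    · intro h'
      linarith [h'.2]

/-- The circle has constant speed `sin r₁`, and `k₁ sin r₁ = cos r₁ = a / √(1 + a²)`; the other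
factor is the angle of the arc. Nonnegativity of `a` and `b` keeps the arc within a half circle. -/
theorem sideCurvature_eq_formula {φ a b : ℝ} (hφ : φ ∈ Ioo 0 (Real.pi / 2)) (ha : 0 ≤ a)
    (hb : 0 ≤ b) : sideCurvature φ a b = sideCurvatureFormula φ a b := by
  have hsφ : 0 < Real.sin φ := Real.sin_pos_of_pos_of_lt_pi hφ.1 (by linarith [hφ.2, Real.pi_pos])
  have hcφ : 0 < Real.cos φ := Real.cos_pos_of_mem_Ioo ⟨by linarith [hφ.1, Real.pi_pos], hφ.2⟩
  have hsa : 0 < √(1 + a ^ 2) := by positivity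
  have hsb : 0 < √(1 + b ^ 2) := by positivity
  have hs₁ : 0 < Real.sin (radius a) := by rw [sin_radius]; positivity
  have hA : 0 ≤ (a * Real.cos φ + b) / (Real.sin φ * √(1 + a ^ 2)) := by positivity
  have hset : {θ ∈ Ioc (-Real.pi) Real.pi |
      circleOne (radius a) θ ∈ sphericalDisk (centerTwo φ (radius b)) (radius b)} =
      Ioo 0 (Real.pi - 2 * Real.arctan ((a * Real.cos φ + b) / (Real.sin φ * √(1 + a ^ 2)))) := by
    ext θ
    have key : θ ∈ Ioc (-Real.pi) Real.pi →
        (circleOne (radius a) θ ∈ sphericalDisk (centerTwo φ (radius b)) (radius b) ↔ θ ∈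
        Ioo 0 (Real.pi - 2 * Real.arctan ((a * Real.cos φ + b) / (Real.sin φ * √(1 + a ^ 2))))) := by
      intro hθ
      rw [circleOne_mem_sphericalDisk_iff hs₁ (radius_mem_Ioo b), sin_radius, sin_radius,
        cos_radius, cos_radius, one_sub_cos_mul_lt_iff (by positivity) (by positivity) hθ]
      congr! 5
      field_simp
    constructor
    · intro h
      exact (key h.1).1 h.2
    · intro h
      have hθ : θ ∈ Ioc (-Real.pi) Real.pi :=
        ⟨by linarith [h.1, Real.pi_pos], by linarith [h.2, Real.arctan_nonneg.2 hA]⟩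
      exact ⟨hθ, (key hθ).2 h⟩
  unfold sideCurvature bigonSideLength sideCurvatureFormula
  simp only [norm_deriv_circleOne hs₁.le]
  rw [hset, MeasureTheory.setIntegral_const, sin_radius, Real.volume_real_Ioo_of_le]
  · simp only [smul_eq_mul]
    ring
  · linarith [Real.arctan_lt_pi_div_two ((a * Real.cos φ + b) / (Real.sin φ * √(1 + a ^ 2)))]

/-! ### Properties of the closed form -/

theorem strictMono_div_sqrt_one_add_sq : StrictMono fun a : ℝ => a / √(1 + a ^ 2) := by
  simpa only [Real.sin_arctan] using Real.sin_arctan_strictMono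

theorem abs_div_sqrt_one_add_sq_le_one (a : ℝ) : |a / √(1 + a ^ 2)| ≤ 1 := by
  rw [← Real.sin_arctan]
  exact Real.abs_sin_le_one _

theorem tendsto_div_sqrt_one_add_sq_atTop :
    Tendsto (fun a : ℝ => a / √(1 + a ^ 2)) atTop (𝓝 1) := by
  simp only [← Real.sin_arctan]
  have h : Tendsto Real.arctan atTop (𝓝 (Real.pi / 2)) :=
    tendsto_nhds_of_tendsto_nhdsWithin Real.tendsto_arctan_atTop
  simpa [Function.comp_def] using (Real.continuous_sin.tendsto _).comp h

theorem sin_mul_cos_lt_self {x : ℝ} (hx : 0 < x) : Real.sin x * Real.cos x < x := by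
  have h := Real.sin_lt (x := 2 * x) (by linarith)
  rw [Real.sin_two_mul] at h
  linarith

/-- The function `y ↦ y arccot y` is strictly increasing on `[0, ∞)`. -/
theorem strictMonoOn_mul_arccot :
    StrictMonoOn (fun y : ℝ => y * (Real.pi / 2 - Real.arctan y)) (Ici 0) := by
  apply strictMonoOn_of_deriv_pos (convex_Ici 0)
  · exact (continuous_id.mul (continuous_const.sub Real.continuous_arctan)).continuousOn
  · intro y _
    have hd : HasDerivAt (fun y : ℝ => y * (Real.pi / 2 - Real.arctan y))
        (1 * (Real.pi / 2 - Real.arctan y) + y * -(1 / (1 + y ^ 2))) y :=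
      (hasDerivAt_id y).mul ((Real.hasDerivAt_arctan y).const_sub _)
    rw [hd.deriv]
    -- For `x = arccot y` the derivative is `x - sin x cos x`.
    have h := sin_mul_cos_lt_self (x := Real.pi / 2 - Real.arctan y)
      (by linarith [Real.arctan_lt_pi_div_two y])
    have hs : √(1 + y ^ 2) * √(1 + y ^ 2) = 1 + y ^ 2 := Real.mul_self_sqrt (by positivity)
    rw [Real.sin_pi_div_two_sub, Real.cos_pi_div_two_sub, Real.sin_arctan, Real.cos_arctan,
      div_mul_div_comm, hs, one_mul] at h
    have e : y * -(1 / (1 + y ^ 2)) = -(y / (1 + y ^ 2)) := by ring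
    rw [e]
    linarith

theorem sideCurvatureFormula_zero_left (φ b : ℝ) : sideCurvatureFormula φ 0 b = 0 := by
  simp [sideCurvatureFormula]

/-- Without sign conditions, because `IsScalingCooperative` asks for a bound on the whole space. -/
theorem abs_sideCurvatureFormula_le (φ a b : ℝ) :
    |sideCurvatureFormula φ a b| ≤ 2 * Real.pi := by
  unfold sideCurvatureFormula
  set y := (a * Real.cos φ + b) / (Real.sin φ * √(1 + a ^ 2))
  have h₁ := Real.arctan_lt_pi_div_two y
  have h₂ := Real.neg_pi_div_two_lt_arctan y
  rw [abs_mul]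
  calc |a / √(1 + a ^ 2)| * |Real.pi - 2 * Real.arctan y| ≤ 1 * (2 * Real.pi) := by
        gcongr
        · exact abs_div_sqrt_one_add_sq_le_one a
        · rw [abs_le]; constructor <;> linarith
    _ = 2 * Real.pi := one_mul _

theorem sideCurvatureFormula_pos {φ a b : ℝ} (ha : 0 < a) : 0 < sideCurvatureFormula φ a b := by
  unfold sideCurvatureFormula
  have h := Real.arctan_lt_pi_div_two ((a * Real.cos φ + b) / (Real.sin φ * √(1 + a ^ 2)))
  have : 0 < Real.pi - 2 * Real.arctan ((a * Real.cos φ + b) / (Real.sin φ * √(1 + a ^ 2))) := by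
    linarith
  positivity

theorem contDiff_sideCurvatureFormula {n : WithTop ℕ∞} {φ : ℝ} (hφ : 0 < Real.sin φ) :
    ContDiff ℝ n fun p : ℝ × ℝ => sideCurvatureFormula φ p.1 p.2 := by
  unfold sideCurvatureFormula
  have hs : ContDiff ℝ n fun p : ℝ × ℝ => √(1 + p.1 ^ 2) :=
    (contDiff_const.add (contDiff_fst.pow 2)).sqrt fun p => by positivity
  refine (contDiff_fst.div hs fun p => by positivity).mul (contDiff_const.sub
    (contDiff_const.mul (Real.contDiff_arctan.comp ?_)))
  exact ((contDiff_fst.mul contDiff_const).add contDiff_snd).div (contDiff_const.mul hs)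
    fun p => by positivity

theorem sideCurvatureFormula_antitone {φ a : ℝ} (hφ : 0 < Real.sin φ) (ha : 0 ≤ a) :
    Antitone (sideCurvatureFormula φ a) := by
  intro b b' h
  unfold sideCurvatureFormula
  have := Real.arctan_mono (show (a * Real.cos φ + b) / (Real.sin φ * √(1 + a ^ 2)) ≤
    (a * Real.cos φ + b') / (Real.sin φ * √(1 + a ^ 2)) by gcongr)
  gcongr

/-- With the scale-invariant `c = (a cos φ + b) / (a sin φ)` and `y = c · a / √(1 + a²)`, the closed
form is `(2 / c) · y arccot y`. Scaling up increases `y`, hence `y arccot y`. -/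
theorem sideCurvatureFormula_lt_of_scaling {φ a b t : ℝ} (hs : 0 < Real.sin φ)
    (hc : 0 < Real.cos φ) (ha : 0 < a) (hb : 0 ≤ b) (ht : 1 < t) :
    sideCurvatureFormula φ a b < sideCurvatureFormula φ (t * a) (t * b) := by
  have key : ∀ s, 0 < s → sideCurvatureFormula φ (s * a) (s * b) =
      2 / ((a * Real.cos φ + b) / (a * Real.sin φ)) *
        ((a * Real.cos φ + b) / (a * Real.sin φ) * (s * a / √(1 + (s * a) ^ 2)) *
          (Real.pi / 2 - Real.arctan
            ((a * Real.cos φ + b) / (a * Real.sin φ) * (s * a / √(1 + (s * a) ^ 2))))) := by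
    intro s hs'
    have e : (s * a * Real.cos φ + s * b) / (Real.sin φ * √(1 + (s * a) ^ 2)) =
        (a * Real.cos φ + b) / (a * Real.sin φ) * (s * a / √(1 + (s * a) ^ 2)) := by
      field_simp
    unfold sideCurvatureFormula
    rw [e]
    have : (a * Real.cos φ + b) / (a * Real.sin φ) ≠ 0 := by positivity
    field_simp
  have h₁ := key 1 one_pos
  rw [one_mul, one_mul] at h₁
  rw [h₁, key t (by linarith)]
  have hx := strictMono_div_sqrt_one_add_sq (show a < t * a by nlinarith)
  refine mul_lt_mul_of_pos_left (strictMonoOn_mul_arccot ?_ ?_ ?_) (by positivity)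
  · exact mem_Ici.2 (by positivity)
  · exact mem_Ici.2 (by positivity)
  · exact mul_lt_mul_of_pos_left hx (by positivity)

/-! ### Euclidean comparison and the limit of infinite curvature -/

/-- Comparison with the Euclidean limit. -/
theorem le_sideCurvatureFormula {φ a b : ℝ} (hs : 0 < Real.sin φ) (hc : 0 < Real.cos φ)
    (ha : 0 < a) (hb : 0 ≤ b) :
    a / √(1 + a ^ 2) * (Real.pi - 2 * Real.arctan ((a * Real.cos φ + b) / (Real.sin φ * a))) ≤
      sideCurvatureFormula φ a b := by
  unfold sideCurvatureFormula
  have h : a ≤ √(1 + a ^ 2) := Real.le_sqrt_of_sq_le (by linarith)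
  have := Real.arctan_mono (show (a * Real.cos φ + b) / (Real.sin φ * √(1 + a ^ 2)) ≤
    (a * Real.cos φ + b) / (Real.sin φ * a) by gcongr)
  gcongr

theorem arctan_cos_div_sin {φ : ℝ} (hφ : φ ∈ Ioo 0 (Real.pi / 2)) :
    Real.arctan (Real.cos φ / Real.sin φ) = Real.pi / 2 - φ := by
  rw [← Real.sin_pi_div_two_sub, ← Real.cos_pi_div_two_sub φ, ← Real.tan_eq_sin_div_cos,
    Real.arctan_tan] <;> linarith [hφ.1, hφ.2]

/-- In a Euclidean triangle with sides `a`, `b` and exterior angle `φ` between them, the other two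
angles add up to `φ`. -/
theorem arctan_add_arctan_eq {φ a b : ℝ} (hφ : φ ∈ Ioo 0 (Real.pi / 2)) (ha : 0 < a)
    (hb : 0 < b) :
    Real.arctan ((a * Real.cos φ + b) / (Real.sin φ * a)) +
      Real.arctan ((b * Real.cos φ + a) / (Real.sin φ * b)) = Real.pi - φ := by
  have hs : 0 < Real.sin φ := Real.sin_pos_of_pos_of_lt_pi hφ.1 (by linarith [hφ.2, Real.pi_pos])
  have hc : 0 < Real.cos φ := Real.cos_pos_of_mem_Ioo ⟨by linarith [hφ.1, Real.pi_pos], hφ.2⟩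
  have h1 : 0 < (a * Real.cos φ + b) / (Real.sin φ * a) := by positivity
  have h2 : 0 < (b * Real.cos φ + a) / (Real.sin φ * b) := by positivity
  have e₁ := Real.arctan_inv_of_pos h1
  have e₂ := Real.arctan_inv_of_pos h2
  have hsc := Real.sin_sq_add_cos_sq φ
  -- The reciprocals are the tangents of the two triangle angles. Their product is below `1`, so the
  -- addition formula applies without a correction by `π`, and it yields `tan φ`.
  have hlt : ((a * Real.cos φ + b) / (Real.sin φ * a))⁻¹ *
      ((b * Real.cos φ + a) / (Real.sin φ * b))⁻¹ < 1 := by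
    rw [inv_div, inv_div, div_mul_div_comm, div_lt_one (by positivity)]
    have hsq : Real.sin φ ^ 2 ≤ 1 := by nlinarith
    have : a * b * Real.sin φ ^ 2 ≤ a * b * 1 := by gcongr
    nlinarith [mul_pos (mul_pos ha hb) (mul_pos hc hc), mul_pos (mul_pos ha ha) hc,
      mul_pos (mul_pos hb hb) hc]
  have e₃ := Real.arctan_add hlt
  have hne : (a * Real.cos φ + b) * (b * Real.cos φ + a) -
      Real.sin φ * a * (Real.sin φ * b) =
      Real.cos φ * (a ^ 2 + b ^ 2 + 2 * a * b * Real.cos φ) := by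
    linear_combination a * b * hsc.symm
  have e₄ : (((a * Real.cos φ + b) / (Real.sin φ * a))⁻¹ +
      ((b * Real.cos φ + a) / (Real.sin φ * b))⁻¹) /
      (1 - ((a * Real.cos φ + b) / (Real.sin φ * a))⁻¹ *
      ((b * Real.cos φ + a) / (Real.sin φ * b))⁻¹) = Real.tan φ := by
    rw [inv_div, inv_div, div_mul_div_comm, div_add_div _ _ (by positivity) (by positivity),
      one_sub_div (by positivity), div_div_div_cancel_right₀ (by positivity), hne,
      Real.tan_eq_sin_div_cos]
    rw [div_eq_div_iff (by positivity) (by positivity)]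
    ring
  rw [e₄, Real.arctan_tan (by linarith [hφ.1, Real.pi_pos]) hφ.2] at e₃
  linarith

/-- The Euclidean angles `π - 2u` and `π - 2v` of the two sides add up to `2φ`. Bounding both
prefactors below by their minimum makes the estimate independent of the ratio `a / b`. -/
theorem le_sideCurvatureFormula_add {φ a b : ℝ} (hφ : φ ∈ Ioo 0 (Real.pi / 2)) (ha : 0 < a)
    (hb : 0 < b) :
    min (a / √(1 + a ^ 2)) (b / √(1 + b ^ 2)) * (2 * φ) ≤
      sideCurvatureFormula φ a b + sideCurvatureFormula φ b a := by
  have hs : 0 < Real.sin φ := Real.sin_pos_of_pos_of_lt_pi hφ.1 (by linarith [hφ.2, Real.pi_pos])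
  have hc : 0 < Real.cos φ := Real.cos_pos_of_mem_Ioo ⟨by linarith [hφ.1, Real.pi_pos], hφ.2⟩
  refine le_trans ?_ (add_le_add (le_sideCurvatureFormula hs hc ha hb.le)
    (le_sideCurvatureFormula hs hc hb ha.le))
  have h := arctan_add_arctan_eq hφ ha hb
  have h₁ := Real.arctan_lt_pi_div_two ((a * Real.cos φ + b) / (Real.sin φ * a))
  have h₂ := Real.arctan_lt_pi_div_two ((b * Real.cos φ + a) / (Real.sin φ * b))
  set u := Real.arctan ((a * Real.cos φ + b) / (Real.sin φ * a))
  set v := Real.arctan ((b * Real.cos φ + a) / (Real.sin φ * b))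
  calc min (a / √(1 + a ^ 2)) (b / √(1 + b ^ 2)) * (2 * φ)
      = min (a / √(1 + a ^ 2)) (b / √(1 + b ^ 2)) * (Real.pi - 2 * u) +
        min (a / √(1 + a ^ 2)) (b / √(1 + b ^ 2)) * (Real.pi - 2 * v) := by
        linear_combination 2 * min (a / √(1 + a ^ 2)) (b / √(1 + b ^ 2)) * h
    _ ≤ _ := add_le_add
        (mul_le_mul_of_nonneg_right (min_le_left _ _) (by linarith))
        (mul_le_mul_of_nonneg_right (min_le_right _ _) (by linarith))

/-- If the first curvature tends to infinity while the second one stays bounded, the curvature of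
the first side tends to the whole `2φ`. -/
theorem tendsto_euclidean_sideCurvature {α : Type*} {l : Filter α} {φ β : ℝ} {a b : α → ℝ}
    (hφ : φ ∈ Ioo 0 (Real.pi / 2)) (ha : Tendsto a l atTop) (hb : Tendsto b l (𝓝 β)) :
    Tendsto (fun x => a x / √(1 + a x ^ 2) *
      (Real.pi - 2 * Real.arctan ((a x * Real.cos φ + b x) / (Real.sin φ * a x)))) l
      (𝓝 (2 * φ)) := by
  have hs : 0 < Real.sin φ := Real.sin_pos_of_pos_of_lt_pi hφ.1 (by linarith [hφ.2, Real.pi_pos])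
  have h₁ : Tendsto (fun x => Real.cos φ / Real.sin φ + b x * (a x)⁻¹ / Real.sin φ) l
      (𝓝 (Real.cos φ / Real.sin φ + β * 0 / Real.sin φ)) :=
    ((hb.mul ha.inv_tendsto_atTop).div_const _).const_add _
  rw [mul_zero, zero_div, add_zero] at h₁
  have h₂ : Tendsto (fun x => (a x * Real.cos φ + b x) / (Real.sin φ * a x)) l
      (𝓝 (Real.cos φ / Real.sin φ)) := by
    refine h₁.congr' ?_
    filter_upwards [ha.eventually_gt_atTop 0] with x hx
    field_simp
  have h₃ := (Real.continuous_arctan.tendsto _).comp h₂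
  rw [arctan_cos_div_sin hφ] at h₃
  have h₄ := (tendsto_div_sqrt_one_add_sq_atTop.comp ha).mul ((h₃.const_mul 2).const_sub Real.pi)
  rwa [show 1 * (Real.pi - 2 * (Real.pi / 2 - φ)) = 2 * φ by ring] at h₄

/-! ### Global solutions of ordinary differential equations with bounded `C¹` vector field -/

section ODE

variable {X : Type*} [NormedAddCommGroup X] [NormedSpace ℝ X] [ProperSpace X]

/-- On `[0, t]` both curves stay in a common ball, where the `C¹` field is Lipschitz. -/
theorem eqOn_Ico_of_hasDerivWithinAt {v : X → X} (hv : ContDiff ℝ 1 v) {T : ℝ} {f g : ℝ → X}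
    (hf : ∀ t ∈ Ico 0 T, HasDerivWithinAt f (v (f t)) (Ico 0 T) t)
    (hg : ∀ t ∈ Ico 0 T, HasDerivWithinAt g (v (g t)) (Ico 0 T) t) (h0 : f 0 = g 0) :
    EqOn f g (Ico 0 T) := by
  intro t ht
  have hsub : Icc 0 t ⊆ Ico 0 T := fun s hs => ⟨hs.1, hs.2.trans_lt ht.2⟩
  have hfc : ContinuousOn f (Icc 0 t) :=
    fun s hs => ((hf s (hsub hs)).continuousWithinAt).mono hsub
  have hgc : ContinuousOn g (Icc 0 t) :=
    fun s hs => ((hg s (hsub hs)).continuousWithinAt).mono hsub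
  obtain ⟨R, hR⟩ := ((isCompact_Icc.image_of_continuousOn hfc).union
    (isCompact_Icc.image_of_continuousOn hgc)).isBounded.subset_closedBall 0
  obtain ⟨K, hK⟩ := (hv.contDiffOn (s := Metric.closedBall 0 R)).exists_lipschitzOnWith one_ne_zero
    (convex_closedBall 0 R) (isCompact_closedBall 0 R)
  have right : ∀ {h : ℝ → X}, (∀ t ∈ Ico 0 T, HasDerivWithinAt h (v (h t)) (Ico 0 T) t) →
      ∀ s ∈ Ico 0 t, HasDerivWithinAt h (v (h s)) (Ici s) s := by
    intro h hh s hs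
    have hsT : s ∈ Ico 0 T := ⟨hs.1, hs.2.trans ht.2⟩
    refine (hh s hsT).mono_of_mem_nhdsWithin ?_
    exact mem_of_superset (Ico_mem_nhdsGE hsT.2) (Ico_subset_Ico_left hs.1)
  exact ODE_solution_unique_of_mem_Icc_right (v := fun _ => v)
    (s := fun _ => Metric.closedBall 0 R) (fun _ _ => hK) hfc (right hf)
    (fun s hs => hR (Or.inl ⟨s, Ico_subset_Icc_self hs, rfl⟩)) hgc (right hg)
    (fun s hs => hR (Or.inr ⟨s, Ico_subset_Icc_self hs, rfl⟩)) h0 ⟨ht.1, le_rfl⟩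

/-- A curve of speed at most `C` stays within distance `CT` of its start, so Picard–Lindelöf on that
ball reaches time `T` with no smallness condition. -/
theorem exists_hasDerivWithinAt_Icc_of_bounded {v : X → X} (hv : ContDiff ℝ 1 v) {C : ℝ}
    (hC : ∀ x, ‖v x‖ ≤ C) (x₀ : X) {T : ℝ} (hT : 0 ≤ T) :
    ∃ f : ℝ → X, f 0 = x₀ ∧ ∀ t ∈ Icc 0 T, HasDerivWithinAt f (v (f t)) (Icc 0 T) t := by
  have hC0 : 0 ≤ C := (norm_nonneg _).trans (hC x₀)
  lift C to NNReal using hC0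
  lift T to NNReal using hT
  obtain ⟨K, hK⟩ := (hv.contDiffOn (s := Metric.closedBall x₀ (C * T : NNReal))
    ).exists_lipschitzOnWith one_ne_zero (convex_closedBall _ _) (isCompact_closedBall _ _)
  have hpl : IsPicardLindelof (fun _ => v) (⟨0, le_rfl, T.2⟩ : Icc (0 : ℝ) T) x₀ (C * T) 0 C K :=
    IsPicardLindelof.of_time_independent (fun x _ => hC x) hK (by simp)
  exact hpl.exists_eq_forall_mem_Icc_hasDerivWithinAt₀

theorem exists_hasDerivWithinAt_Ici_of_bounded {v : X → X} (hv : ContDiff ℝ 1 v) {C : ℝ}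
    (hC : ∀ x, ‖v x‖ ≤ C) (x₀ : X) :
    ∃ f : ℝ → X, f 0 = x₀ ∧ ∀ t ∈ Ici (0 : ℝ), HasDerivWithinAt f (v (f t)) (Ici 0) t := by
  choose α hα0 hα using fun n : ℕ =>
    exists_hasDerivWithinAt_Icc_of_bounded hv hC x₀ (Nat.cast_nonneg (α := ℝ) n)
  have hα' : ∀ n : ℕ, ∀ T ≤ (n : ℝ), ∀ t ∈ Ico 0 T,
      HasDerivWithinAt (α n) (v (α n t)) (Ico 0 T) t := fun n T hT t ht =>
    (hα n t ⟨ht.1, (ht.2.trans_le hT).le⟩).mono fun s hs => ⟨hs.1, (hs.2.trans_le hT).le⟩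
  have heq : ∀ m n : ℕ, m ≤ n → EqOn (α m) (α n) (Ico 0 m) := fun m n hmn =>
    eqOn_Ico_of_hasDerivWithinAt hv (hα' m m le_rfl) (hα' n m (Nat.cast_le.2 hmn))
      ((hα0 m).trans (hα0 n).symm)
  -- Uniqueness glues the solutions on `[0, n]`. The index `⌊t⌋₊ + 1` puts `t` strictly inside its
  -- interval.
  have heq' : ∀ n : ℕ, EqOn (fun t => α (⌊t⌋₊ + 1) t) (α n) (Ico 0 n) := by
    intro n t ht
    have hlt : t < ((⌊t⌋₊ + 1 : ℕ) : ℝ) := by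
      push_cast
      exact Nat.lt_floor_add_one t
    rcases le_total (⌊t⌋₊ + 1) n with h | h
    · exact heq _ _ h ⟨ht.1, hlt⟩
    · exact (heq _ _ h ht).symm
  refine ⟨fun t => α (⌊t⌋₊ + 1) t, by simp [hα0], fun t ht => ?_⟩
  obtain ⟨n, hn⟩ := exists_nat_gt t
  have ht' : t ∈ Ico (0 : ℝ) n := ⟨ht, hn⟩
  have h := (hα' n n le_rfl t ht').congr (heq' n) (heq' n ht')
  rw [← heq' n ht'] at h
  refine h.mono_of_mem_nhdsWithin ?_
  rw [← Ici_inter_Iio]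
  exact inter_mem_nhdsWithin _ (Iio_mem_nhds hn)

end ODE

/-! ### Barrier comparison -/

/-- A finite family of functions stays below a barrier if a member which touches the barrier grows
more slowly than the barrier. -/
theorem le_barrier {ι : Type*} [Finite ι] {w w' : ℝ → ι → ℝ} {B B' : ℝ → ℝ}
    (hw : ∀ t ∈ Ici (0 : ℝ), ∀ i, HasDerivWithinAt (fun s => w s i) (w' t i) (Ici 0) t)
    (hB : ∀ t, HasDerivAt B (B' t) t) (h0 : ∀ i, w 0 i ≤ B 0)
    (hlt : ∀ t ∈ Ici (0 : ℝ), ∀ i, (∀ j, w t j ≤ B t) → w t i = B t → w' t i < B' t) :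
    ∀ t ∈ Ici (0 : ℝ), ∀ i, w t i ≤ B t := by
  intro T hT
  have hBc : Continuous B := continuous_iff_continuousAt.2 fun t => (hB t).continuousAt
  have hwc : ∀ i, ContinuousOn (fun s => w s i) (Icc 0 T) := fun i s hs =>
    ((hw s hs.1 i).continuousWithinAt).mono Icc_subset_Ici_self
  have hclosed : IsClosed ({t | ∀ i, w t i ≤ B t} ∩ Icc 0 T) := by
    have : {t | ∀ i, w t i ≤ B t} ∩ Icc 0 T =
        Icc 0 T ∩ ⋂ i, {t ∈ Icc 0 T | w t i ≤ B t} := by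
      ext t
      simp only [mem_inter_iff, mem_iInter, mem_ofPred_eq]
      exact ⟨fun h => ⟨h.2, fun i => ⟨h.2, h.1 i⟩⟩, fun h => ⟨fun i => (h.2 i).2, h.1⟩⟩
    rw [this]
    exact isClosed_Icc.inter (isClosed_iInter fun i =>
      isClosed_Icc.isClosed_le (hwc i) hBc.continuousOn)
  -- Continuous induction: the good times form a closed set that extends to the right of each of its
  -- points.
  refine (hclosed.Icc_subset_of_forall_exists_gt h0 ?_ : Icc 0 T ⊆ _) ⟨hT, le_rfl⟩
  rintro t ⟨ht, ht0⟩ y hy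
  have hev : ∀ᶠ s in 𝓝[>] t, ∀ i, w s i ≤ B s := by
    rw [eventually_all]
    intro i
    have hwi : HasDerivWithinAt (fun s => w s i) (w' t i) (Ioi t) t :=
      (hw t ht0.1 i).mono fun s hs => ht0.1.trans (le_of_lt hs)
    rcases (ht i).lt_or_eq with h | h
    · filter_upwards [hwi.continuousWithinAt.eventually_lt
        hBc.continuousAt.continuousWithinAt h] with s hs using hs.le
    -- At a touching point `w - B` vanishes with negative right derivative, so it is negative just
    -- afterwards.
    · have hd := hwi.sub (hB t).hasDerivWithinAt
      have hneg : w' t i - B' t < 0 := sub_neg.2 (hlt t ht0.1 i ht h)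
      have hslope := (hasDerivWithinAt_iff_tendsto_slope' (lt_irrefl t)).1 hd
      filter_upwards [hslope.eventually_lt_const hneg, self_mem_nhdsWithin] with s hs hts
      have hts' : 0 < s - t := sub_pos.2 hts
      rw [slope_def_field, div_lt_iff₀ hts', zero_mul] at hs
      simp only [Pi.sub_apply] at hs
      linarith
  obtain ⟨s, hs, hs'⟩ := (hev.and (Ioc_mem_nhdsGT hy)).exists
  exact ⟨s, hs, hs'⟩

/-! ### Cooperative systems which increase under scaling -/

/-- A bounded `C¹` map on `ℝ^ι` each of whose components is, on positive vectors, nonincreasing in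
the other variables and strictly increasing under simultaneous scaling of all variables. -/
structure IsScalingCooperative {ι : Type*} [Fintype ι] (L : (ι → ℝ) → ι → ℝ) : Prop where
  contDiff : ContDiff ℝ 1 L
  bounded : ∃ C, ∀ k, ‖L k‖ ≤ C
  map_zero : L 0 = 0
  anti : ∀ (k k' : ι → ℝ) (i : ι), (∀ j, 0 < k j) → (∀ j, k j ≤ k' j) → k i = k' i → L k' i ≤ L k i
  scaling : ∀ (k : ι → ℝ) (t : ℝ) (i : ι), (∀ j, 0 < k j) → 1 < t → L k i < L (t • k) i

namespace IsScalingCooperative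

variable {ι : Type*} [Fintype ι] {L : (ι → ℝ) → ι → ℝ}

theorem scaling_lt (h : IsScalingCooperative L) {k : ι → ℝ} (hk : ∀ j, 0 < k j) {s t : ℝ}
    (hs : 0 < s) (hst : s < t) (i : ι) : L (s • k) i < L (t • k) i := by
  have := h.scaling (s • k) (t / s) i (fun j => mul_pos hs (hk j)) ((one_lt_div hs).2 hst)
  rwa [smul_smul, div_mul_cancel₀ _ hs.ne'] at this

theorem scaling_le (h : IsScalingCooperative L) {k : ι → ℝ} (hk : ∀ j, 0 < k j) {s t : ℝ}
    (hs : 0 < s) (hst : s ≤ t) (i : ι) : L (s • k) i ≤ L (t • k) i := by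
  rcases hst.eq_or_lt with rfl | hst
  · exact le_rfl
  · exact (h.scaling_lt hk hs hst i).le

/-- A maximal subsolution is a solution. -/
theorem exists_eq (h : IsScalingCooperative L) {Lhat : ι → ℝ} (hL : ∀ i, 0 < Lhat i)
    (hbdd : ∀ ε > 0, Bornology.IsBounded {k | (∀ i, ε ≤ k i) ∧ ∀ i, L k i ≤ Lhat i}) :
    ∃ k, (∀ i, 0 < k i) ∧ L k = Lhat := by
  classical
  have hLc : Continuous L := h.contDiff.continuous
  -- Since `L 0 = 0 < L̂`, a small constant vector is a strict subsolution; it makes the set below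
  -- nonempty.
  obtain ⟨ε, hε, hεL⟩ : ∃ ε > 0, ∀ i, L (fun _ => ε) i < Lhat i := by
    have hc : Continuous fun ε : ℝ => L fun _ => ε := hLc.comp (continuous_pi fun _ => continuous_id)
    have hev : ∀ᶠ ε in 𝓝[>] (0 : ℝ), ∀ i, L (fun _ => ε) i < Lhat i := by
      rw [eventually_all]
      intro i
      have hci := ((continuous_apply i).comp hc).tendsto 0
      have hz : L (fun _ => 0) = 0 := h.map_zero
      simp only [Function.comp_apply, hz, Pi.zero_apply] at hci
      exact (hci.eventually_lt_const (hL i)).filter_mono nhdsWithin_le_nhds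
    obtain ⟨ε, h₁, h₂⟩ := (hev.and self_mem_nhdsWithin).exists
    exact ⟨ε, h₂, h₁⟩
  set A : Set (ι → ℝ) := {k | (∀ i, ε ≤ k i) ∧ ∀ i, L k i ≤ Lhat i} with hA
  have hAc : IsClosed A := by
    have : A = (⋂ i, {k | ε ≤ k i}) ∩ ⋂ i, {k | L k i ≤ Lhat i} := by
      ext k; simp [hA]
    rw [this]
    exact (isClosed_iInter fun i => isClosed_le continuous_const (continuous_apply i)).inter
      (isClosed_iInter fun i => isClosed_le ((continuous_apply i).comp hLc) continuous_const)
  have hAcomp : IsCompact A := Metric.isCompact_of_isClosed_isBounded hAc (hbdd ε hε)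
  obtain ⟨k, hkA, hkmax⟩ := hAcomp.exists_isMaxOn ⟨fun _ => ε, fun _ => le_rfl, fun i => (hεL i).le⟩
    (continuous_finsetSum (M := ℝ) Finset.univ fun i _ => continuous_apply i).continuousOn
  have hkpos : ∀ i, 0 < k i := fun i => hε.trans_le (hkA.1 i)
  refine ⟨k, hkpos, ?_⟩
  funext i
  by_contra hne
  have hlt : L k i < Lhat i := lt_of_le_of_ne (hkA.2 i) hne
  have hc : Continuous fun s : ℝ => L (Function.update k i s) i :=
    (continuous_apply i).comp (hLc.comp (continuous_const.update i continuous_id))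
  -- Where the inequality is strict, `k i` can be raised slightly. This does not increase the other
  -- components of `L`, so the result is a subsolution with a larger sum.
  have hev : ∀ᶠ s in 𝓝[>] (k i), L (Function.update k i s) i < Lhat i := by
    have := hc.tendsto (k i)
    simp only [Function.update_eq_self] at this
    exact (this.eventually_lt_const hlt).filter_mono nhdsWithin_le_nhds
  obtain ⟨s, hs, hks⟩ := (hev.and self_mem_nhdsWithin).exists
  have hks : k i < s := hks
  have hle : ∀ j, k j ≤ Function.update k i s j := fun j => by
    rcases eq_or_ne j i with rfl | hj
    · simpa using hks.le
    · simp [hj]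
  have hmem : Function.update k i s ∈ A := by
    refine ⟨fun j => (hkA.1 j).trans (hle j), fun j => ?_⟩
    rcases eq_or_ne j i with rfl | hj
    · exact hs.le
    · exact (h.anti k _ j hkpos hle (by simp [hj])).trans (hkA.2 j)
  have hsum : ∑ j, k j < ∑ j, Function.update k i s j :=
    Finset.sum_lt_sum (fun j _ => hle j) ⟨i, Finset.mem_univ i, by simpa using hks⟩
  exact absurd (hkmax hmem) (not_le.2 hsum)

/-- Let the ratio `ρ = k' m / k m` be maximal and suppose `ρ > 1`. Then `ρ k` dominates `k'` with
equality at `m`, so `L k m < L (ρ k) m ≤ L k' m`, a contradiction. -/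
theorem le_of_eq (h : IsScalingCooperative L) {k k' : ι → ℝ} (hk : ∀ i, 0 < k i)
    (hk' : ∀ i, 0 < k' i) (heq : L k = L k') (i : ι) : k' i ≤ k i := by
  have : Nonempty ι := ⟨i⟩
  obtain ⟨m, hm⟩ := Finite.exists_max fun j => k' j / k j
  by_contra hlt
  have h1 : 1 < k' m / k m := ((one_lt_div (hk i)).2 (not_le.1 hlt)).trans_le (hm i)
  have h2 := h.scaling k _ m hk h1
  have h3 := h.anti k' ((k' m / k m) • k) m hk' (fun j => (div_le_iff₀ (hk j)).1 (hm j))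
    (div_mul_cancel₀ _ (hk m).ne').symm
  rw [← heq] at h3
  linarith

theorem eq_of_eq (h : IsScalingCooperative L) {k k' : ι → ℝ} (hk : ∀ i, 0 < k i)
    (hk' : ∀ i, 0 < k' i) (heq : L k = L k') : k = k' :=
  funext fun i => le_antisymm (h.le_of_eq hk' hk heq.symm i) (h.le_of_eq hk hk' heq i)

/-- The vector field of the flow in logarithmic coordinates. -/
theorem contDiff_log_field (h : IsScalingCooperative L) (Lhat : ι → ℝ) :
    ContDiff ℝ 1 fun u : ι → ℝ => Lhat - L fun i => Real.exp (u i) :=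
  contDiff_const.sub (h.contDiff.comp
    (contDiff_pi.2 fun i => Real.contDiff_exp.comp (contDiff_apply ℝ ℝ i)))

/-- Exponentially decaying barrier `ε + M e^{-ct}` whose slope is greater than `-δ`. -/
theorem exists_barrier {w w' : ℝ → ι → ℝ} {ε δ : ℝ} (hδ : 0 < δ)
    (hw : ∀ t ∈ Ici (0 : ℝ), ∀ i, HasDerivWithinAt (fun s => w s i) (w' t i) (Ici 0) t)
    (hlt : ∀ t ∈ Ici (0 : ℝ), ∀ i, ∀ y, ε ≤ y → (∀ j, w t j ≤ y) → w t i = y → w' t i ≤ -δ)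
    (hε : 0 < ε) : ∀ᶠ t in atTop, ∀ i, w t i < 2 * ε := by
  set M : ℝ := 1 + ∑ i, |w 0 i| with hM
  have hM0 : 0 < M := by positivity
  -- With this rate the barrier has slope at least `-cM = -δ/2 > -δ` for `t ≥ 0`, while `M` puts it
  -- above all initial values.
  set c : ℝ := δ / (2 * M) with hc
  have hc0 : 0 < c := by positivity
  have hcM : c * M = δ / 2 := by rw [hc]; field_simp
  have hB : ∀ t : ℝ, HasDerivAt (fun t => ε + M * Real.exp (-c * t))
      (M * (Real.exp (-c * t) * (-c * 1))) t := fun t =>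
    ((((hasDerivAt_id t).const_mul (-c)).exp).const_mul M).const_add ε
  have hle := le_barrier hw hB ?_ ?_
  · have hlim : Tendsto (fun t : ℝ => ε + M * Real.exp (-c * t)) atTop (𝓝 (ε + M * 0)) := by
      refine ((Real.tendsto_exp_atBot.comp ?_).const_mul M).const_add ε
      exact tendsto_id.const_mul_atTop_of_neg (neg_lt_zero.2 hc0)
    filter_upwards [hlim.eventually_lt_const (show ε + M * 0 < 2 * ε by linarith),
      eventually_ge_atTop 0] with t ht ht0 i
    exact (hle t ht0 i).trans_lt ht
  · intro i
    have h1 : |w 0 i| ≤ ∑ j, |w 0 j| :=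
      Finset.single_le_sum (f := fun j => |w 0 j|) (fun j _ => abs_nonneg _) (Finset.mem_univ i)
    simp only [mul_zero, Real.exp_zero, mul_one]
    linarith [le_abs_self (w 0 i)]
  · intro t ht i hj hi
    have hexp : 0 < Real.exp (-c * t) := Real.exp_pos _
    have hexp1 : Real.exp (-c * t) ≤ 1 := Real.exp_le_one_iff.2 (by
      rw [neg_mul]; exact neg_nonpos.2 (mul_nonneg hc0.le ht))
    have h1 := hlt t ht i _ (le_add_of_nonneg_right (by positivity)) hj hi
    have h2 : M * (Real.exp (-c * t) * (-c * 1)) = -(δ / 2) * Real.exp (-c * t) := by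
      rw [← hcM]; ring
    rw [h2]
    nlinarith

/-- If the largest `u_j - log k̂_j` equals `y ≥ ε` and is attained at `i`, then `e^u ≤ e^y k̂` with
equality at `i`. Hence `L_i(e^u) ≥ L_i(e^y k̂) ≥ L_i(e^ε k̂) > L_i(k̂) + δ`, so `u_i` falls at rate
at least `δ`. The smallest coordinate is treated symmetrically. -/
theorem tendsto_of_flow (h : IsScalingCooperative L) {khat : ι → ℝ} (hk : ∀ i, 0 < khat i)
    {u : ℝ → ι → ℝ}
    (hu : ∀ t ∈ Ici (0 : ℝ), HasDerivWithinAt u (L khat - L fun i => Real.exp (u t i)) (Ici 0) t) :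
    Tendsto (fun t i => Real.exp (u t i)) atTop (𝓝 khat) := by
  have hupper : ∀ ε > 0, ∀ᶠ t in atTop, ∀ i, u t i - Real.log (khat i) < 2 * ε := by
    intro ε hε
    obtain ⟨δ, hδ, hδ0⟩ : ∃ δ, (∀ i, δ < L (Real.exp ε • khat) i - L khat i) ∧ 0 < δ := by
      refine ((eventually_all.2 fun i => ?_).and (self_mem_nhdsWithin :
        ∀ᶠ δ in 𝓝[>] (0 : ℝ), δ ∈ Ioi 0)).exists
      exact (gt_mem_nhds (sub_pos.2
        (h.scaling khat _ i hk (Real.one_lt_exp_iff.2 hε)))).filter_mono nhdsWithin_le_nhds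
    refine exists_barrier (w := fun t i => u t i - Real.log (khat i)) hδ0
      (fun t ht i => ((hasDerivWithinAt_pi.1 (hu t ht)) i).sub_const _) ?_ hε
    intro t _ i y hy hj hi
    have h1 := h.anti (fun i => Real.exp (u t i)) (Real.exp y • khat) i
      (fun j => Real.exp_pos _) (fun j => ?_) ?_
    · have h2 := h.scaling_le hk (Real.exp_pos ε) (Real.exp_le_exp.2 hy) i
      have h3 := hδ i
      simp only [Pi.sub_apply]
      linarith
    · have := hj j
      rw [Pi.smul_apply, smul_eq_mul, ← Real.exp_log (hk j), ← Real.exp_add]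
      exact Real.exp_le_exp.2 (by linarith)
    · rw [Pi.smul_apply, smul_eq_mul, ← Real.exp_log (hk i), ← Real.exp_add]
      exact congrArg Real.exp (by linarith)
  have hlower : ∀ ε > 0, ∀ᶠ t in atTop, ∀ i, Real.log (khat i) - u t i < 2 * ε := by
    intro ε hε
    obtain ⟨δ, hδ, hδ0⟩ : ∃ δ, (∀ i, δ < L khat i - L (Real.exp (-ε) • khat) i) ∧ 0 < δ := by
      refine ((eventually_all.2 fun i => ?_).and (self_mem_nhdsWithin :
        ∀ᶠ δ in 𝓝[>] (0 : ℝ), δ ∈ Ioi 0)).exists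
      have h1 := h.scaling_lt hk (Real.exp_pos (-ε))
        (Real.exp_lt_one_iff.2 (neg_lt_zero.2 hε)) i
      rw [one_smul] at h1
      exact (gt_mem_nhds (sub_pos.2 h1)).filter_mono nhdsWithin_le_nhds
    refine exists_barrier (w := fun t i => Real.log (khat i) - u t i) hδ0
      (fun t ht i => ((hasDerivWithinAt_pi.1 (hu t ht)) i).const_sub _) ?_ hε
    intro t _ i y hy hj hi
    have h1 := h.anti (Real.exp (-y) • khat) (fun i => Real.exp (u t i)) i
      (fun j => mul_pos (Real.exp_pos _) (hk j)) (fun j => ?_) ?_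
    · have h2 := h.scaling_le hk (Real.exp_pos (-y)) (Real.exp_le_exp.2 (neg_le_neg hy)) i
      have h3 := hδ i
      simp only [Pi.sub_apply]
      linarith
    · have := hj j
      rw [Pi.smul_apply, smul_eq_mul, ← Real.exp_log (hk j), ← Real.exp_add]
      exact Real.exp_le_exp.2 (by linarith)
    · rw [Pi.smul_apply, smul_eq_mul, ← Real.exp_log (hk i), ← Real.exp_add]
      exact congrArg Real.exp (by linarith)
  rw [tendsto_pi_nhds]
  intro i
  have hlim : Tendsto (fun t => u t i) atTop (𝓝 (Real.log (khat i))) := by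
    rw [Metric.tendsto_nhds]
    intro ε hε
    filter_upwards [hupper (ε / 2) (by positivity), hlower (ε / 2) (by positivity)] with t h1 h2
    rw [Real.dist_eq, abs_lt]
    constructor <;> linarith [h1 i, h2 i]
  have := (Real.continuous_exp.tendsto _).comp hlim
  rwa [Real.exp_log (hk i)] at this

/-- The flow `dkᵢ/dt = -(Lᵢ(k) - L̂ᵢ) kᵢ` on positive vectors has a unique solution, which exists for
all times and converges to the solution of `L k = L̂`. -/
theorem exists_flow (h : IsScalingCooperative L) {khat : ι → ℝ} (hk : ∀ i, 0 < khat i)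
    {k₀ : ι → ℝ} (hk₀ : ∀ i, 0 < k₀ i) :
    ∃ k : ℝ → ι → ℝ,
      (k 0 = k₀ ∧ ∀ t ∈ Ici (0 : ℝ), ∀ i, 0 < k t i ∧
        HasDerivWithinAt (fun s => k s i) (-(L (k t) i - L khat i) * k t i) (Ici 0) t) ∧
      (∀ T > 0, ∀ k' : ℝ → ι → ℝ, k' 0 = k₀ →
        (∀ t ∈ Ico 0 T, ∀ i, 0 < k' t i ∧
          HasDerivWithinAt (fun s => k' s i) (-(L (k' t) i - L khat i) * k' t i) (Ico 0 T) t) →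
        EqOn k' k (Ico 0 T)) ∧
      Tendsto k atTop (𝓝 khat) := by
  obtain ⟨C, hC⟩ := h.bounded
  obtain ⟨u, hu0, hu⟩ := exists_hasDerivWithinAt_Ici_of_bounded (h.contDiff_log_field (L khat))
    (C := C + C) (fun x => (norm_sub_le _ _).trans (add_le_add (hC _) (hC _)))
    (fun i => Real.log (k₀ i))
  refine ⟨fun t i => Real.exp (u t i), ⟨?_, ?_⟩, ?_, h.tendsto_of_flow hk hu⟩
  · funext i
    simp [hu0, Real.exp_log (hk₀ i)]
  · intro t ht i
    refine ⟨Real.exp_pos _, ?_⟩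
    have := (hasDerivWithinAt_pi.1 (hu t ht) i).exp
    convert this using 1
    simp only [Pi.sub_apply]
    ring
  · intro T _ k' hk'0 hk'
    -- Positivity allows taking logarithms of a competing solution, and uniqueness holds for the
    -- logarithmic field.
    have hlog : EqOn (fun t i => Real.log (k' t i)) u (Ico 0 T) := by
      refine eqOn_Ico_of_hasDerivWithinAt (h.contDiff_log_field (L khat)) ?_
        (fun t ht => (hu t ht.1).mono fun s hs => hs.1) ?_
      · intro t ht
        have hexp : (fun i => Real.exp (Real.log (k' t i))) = k' t :=
          funext fun i => Real.exp_log (hk' t ht i).1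
        rw [hexp, hasDerivWithinAt_pi]
        intro i
        have hpos := (hk' t ht i).1
        refine ((hk' t ht i).2.log hpos.ne').congr_deriv ?_
        rw [Pi.sub_apply, mul_div_cancel_right₀ _ hpos.ne', neg_sub]
      · simp only [hk'0, hu0]
    intro t ht
    funext i
    simp only [← hlog ht, Real.exp_log (hk' t ht i).1]

end IsScalingCooperative

variable {S V E F : Type*} [TopologicalSpace S]

/-! ### Total geodesic curvatures in closed form -/

theorem sin_pos_of_mem_Ioo_pi_div_two {φ : ℝ} (hφ : φ ∈ Ioo 0 (Real.pi / 2)) : 0 < Real.sin φ :=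
  Real.sin_pos_of_pos_of_lt_pi hφ.1 (by linarith [hφ.2, Real.pi_pos])

theorem cos_pos_of_mem_Ioo_pi_div_two {φ : ℝ} (hφ : φ ∈ Ioo 0 (Real.pi / 2)) : 0 < Real.cos φ :=
  Real.cos_pos_of_mem_Ioo ⟨by linarith [hφ.1, Real.pi_pos], hφ.2⟩

/-- The contribution of a side to the total geodesic curvature of its face. -/
def sideTerm (D : CellularDecomposition S V E F) (Φ : E → ℝ) (k : F → ℝ) (s : E × Bool) : ℝ :=
  sideCurvatureFormula (Φ s.1) (k (D.face s)) (k (D.face (s.1, !s.2)))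

/-- Closed form of `totalCurvature` for nonnegative curvatures. -/
def totalCurvatureFormula (D : CellularDecomposition S V E F) (Φ : E → ℝ) (k : F → ℝ) (f : F) : ℝ :=
  ∑ j : Fin (D.numSides f), sideTerm D Φ k (D.side.symm ⟨f, j⟩)

theorem face_side_symm (D : CellularDecomposition S V E F) (f : F) (j : Fin (D.numSides f)) :
    D.face (D.side.symm ⟨f, j⟩) = f := by
  simp [CellularDecomposition.face]

theorem totalCurvature_eq_formula (D : CellularDecomposition S V E F) {Φ : E → ℝ}
    (hΦ : ∀ e, Φ e ∈ Ioo 0 (Real.pi / 2)) {k : F → ℝ} (hk : ∀ f, 0 ≤ k f) :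
    totalCurvature D Φ k = totalCurvatureFormula D Φ k := by
  funext f
  refine Finset.sum_congr rfl fun j _ => ?_
  rw [sideTerm, face_side_symm]
  exact sideCurvature_eq_formula (hΦ _) (hk _) (hk _)

theorem totalCurvatureFormula_eq_zero (D : CellularDecomposition S V E F) (Φ : E → ℝ) {k : F → ℝ}
    {f : F} (hf : k f = 0) : totalCurvatureFormula D Φ k f = 0 :=
  Finset.sum_eq_zero fun j _ => by
    rw [sideTerm, face_side_symm, hf, sideCurvatureFormula_zero_left]

theorem totalCurvatureFormula_pos (D : CellularDecomposition S V E F) (Φ : E → ℝ) {k : F → ℝ}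
    {f : F} (hf : 0 < k f) : 0 < totalCurvatureFormula D Φ k f := by
  have : Nonempty (Fin (D.numSides f)) := ⟨⟨0, D.numSides_pos f⟩⟩
  refine Finset.sum_pos (fun j _ => ?_) Finset.univ_nonempty
  rw [sideTerm, face_side_symm]
  exact sideCurvatureFormula_pos hf

/-- The total geodesic curvature of a set of faces, sorted by edges. -/
theorem sum_totalCurvatureFormula [Fintype E] [Fintype F] [DecidableEq F]
    (D : CellularDecomposition S V E F) (Φ : E → ℝ) (k : F → ℝ) (F' : Finset F) :
    ∑ f ∈ F', totalCurvatureFormula D Φ k f =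
      ∑ e : E, ((if D.face (e, true) ∈ F' then sideTerm D Φ k (e, true) else 0) +
        if D.face (e, false) ∈ F' then sideTerm D Φ k (e, false) else 0) := by
  have h₁ : ∑ f ∈ F', totalCurvatureFormula D Φ k f =
      ∑ p : (Σ f : F, Fin (D.numSides f)),
        if p.1 ∈ F' then sideTerm D Φ k (D.side.symm p) else 0 := by
    rw [Fintype.sum_sigma, ← Finset.sum_subset (Finset.subset_univ F')]
    · exact Finset.sum_congr rfl fun f hf => Finset.sum_congr rfl fun j _ => by simp [hf]
    · intro f _ hf
      simp [hf]
  rw [h₁, ← D.side.sum_comp, Fintype.sum_prod_type]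
  simp only [Fintype.sum_bool, Equiv.symm_apply_apply]
  rfl

/-! ### Extension by zero -/

theorem extendZero_of_mem {I : Finset F} (k : I → ℝ) {f : F} (hf : f ∈ I) :
    extendZero I k f = k ⟨f, hf⟩ := dif_pos hf

theorem extendZero_of_notMem {I : Finset F} (k : I → ℝ) {f : F} (hf : f ∉ I) :
    extendZero I k f = 0 := dif_neg hf

theorem extendZero_coe {I : Finset F} (k : I → ℝ) (i : I) : extendZero I k i = k i :=
  extendZero_of_mem k i.2

theorem extendZero_nonneg {I : Finset F} {k : I → ℝ} (hk : ∀ i, 0 < k i) (f : F) :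
    0 ≤ extendZero I k f := by
  by_cases hf : f ∈ I
  · rw [extendZero_of_mem k hf]; exact (hk _).le
  · rw [extendZero_of_notMem k hf]

theorem extendZero_mono {I : Finset F} {k k' : I → ℝ} (h : ∀ i, k i ≤ k' i) (f : F) :
    extendZero I k f ≤ extendZero I k' f := by
  by_cases hf : f ∈ I
  · rw [extendZero_of_mem k hf, extendZero_of_mem k' hf]; exact h _
  · rw [extendZero_of_notMem k hf, extendZero_of_notMem k' hf]

theorem extendZero_smul {I : Finset F} (t : ℝ) (k : I → ℝ) (f : F) :
    extendZero I (t • k) f = t * extendZero I k f := by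
  by_cases hf : f ∈ I
  · rw [extendZero_of_mem _ hf, extendZero_of_mem _ hf]; rfl
  · rw [extendZero_of_notMem _ hf, extendZero_of_notMem _ hf, mul_zero]

theorem contDiff_extendZero_apply {n : WithTop ℕ∞} (I : Finset F) (f : F) :
    ContDiff ℝ n fun k : I → ℝ => extendZero I k f := by
  by_cases hf : f ∈ I
  · simp only [extendZero_of_mem _ hf]
    exact contDiff_apply ℝ ℝ _
  · simp only [extendZero_of_notMem _ hf]
    exact contDiff_const

theorem extendZero_mem_positiveOn {I : Finset F} {k : I → ℝ} (hk : ∀ i, 0 < k i) :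
    extendZero I k ∈ positiveOn I :=
  ⟨fun f hf => by rw [extendZero_of_mem k hf]; exact hk _, fun _ hf => extendZero_of_notMem k hf⟩

/-! ### The reduced system -/

/-- The total geodesic curvatures of the faces of `I` as functions of the curvatures on `I`. -/
def reducedCurvature (D : CellularDecomposition S V E F) (Φ : E → ℝ) (I : Finset F) (k : I → ℝ)
    (i : I) : ℝ :=
  totalCurvatureFormula D Φ (extendZero I k) i

theorem totalCurvature_extendZero (D : CellularDecomposition S V E F) {Φ : E → ℝ}
    (hΦ : ∀ e, Φ e ∈ Ioo 0 (Real.pi / 2)) {I : Finset F} {k : I → ℝ} (hk : ∀ i, 0 < k i) (i : I) :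
    totalCurvature D Φ (extendZero I k) i = reducedCurvature D Φ I k i :=
  congrFun (totalCurvature_eq_formula D hΦ (extendZero_nonneg hk)) i

/-- All properties hold side by side, because extension by zero respects order and scaling. A
neighbour outside `I` enters as `b = 0`, which the scaling lemma allows; strictness of the sum uses
that each face has a side. -/
theorem isScalingCooperative_reducedCurvature (D : CellularDecomposition S V E F) {Φ : E → ℝ}
    (hΦ : ∀ e, Φ e ∈ Ioo 0 (Real.pi / 2)) (I : Finset F) :
    IsScalingCooperative (reducedCurvature D Φ I) where
  contDiff := by
    refine contDiff_pi.2 fun i => ?_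
    unfold reducedCurvature totalCurvatureFormula
    refine ContDiff.sum fun j _ => ?_
    exact (contDiff_sideCurvatureFormula (sin_pos_of_mem_Ioo_pi_div_two (hΦ _))).comp
      ((contDiff_extendZero_apply I _).prodMk (contDiff_extendZero_apply I _))
  bounded := by
    refine ⟨∑ i : I, D.numSides i * (2 * Real.pi), fun k => ?_⟩
    have hpi := Real.pi_pos
    refine (pi_norm_le_iff_of_nonneg (by positivity)).2 fun i => ?_
    calc ‖∑ j, sideTerm D Φ (extendZero I k) (D.side.symm ⟨i, j⟩)‖ ≤ ∑ _j : Fin (D.numSides i), 2 * Real.pi :=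
          norm_sum_le_of_le _ fun j _ => abs_sideCurvatureFormula_le _ _ _
      _ = D.numSides i * (2 * Real.pi) := by simp
      _ ≤ _ := Finset.single_le_sum (f := fun i : I => (D.numSides i : ℝ) * (2 * Real.pi))
          (fun j _ => by positivity) (Finset.mem_univ i)
  map_zero := by
    funext i
    exact totalCurvatureFormula_eq_zero D Φ (extendZero_coe 0 i)
  anti := by
    intro k k' i hk hle hi
    unfold reducedCurvature totalCurvatureFormula
    refine Finset.sum_le_sum fun j _ => ?_
    rw [sideTerm, sideTerm, face_side_symm, extendZero_coe, extendZero_coe, hi]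
    exact sideCurvatureFormula_antitone (sin_pos_of_mem_Ioo_pi_div_two (hΦ _))
      (hi ▸ (hk i).le) (extendZero_mono hle _)
  scaling := by
    intro k t i hk ht
    have : Nonempty (Fin (D.numSides i)) := ⟨⟨0, D.numSides_pos i⟩⟩
    unfold reducedCurvature totalCurvatureFormula
    refine Finset.sum_lt_sum_of_nonempty Finset.univ_nonempty fun j _ => ?_
    rw [sideTerm, sideTerm, face_side_symm, extendZero_smul, extendZero_smul, extendZero_coe]
    exact sideCurvatureFormula_lt_of_scaling (sin_pos_of_mem_Ioo_pi_div_two (hΦ _))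
      (cos_pos_of_mem_Ioo_pi_div_two (hΦ _)) (hk i) (extendZero_nonneg hk _) ht

/-! ### Compactness of the set of subsolutions -/

/-- Along a filter on which every curvature either tends to infinity or converges, the contribution
of an edge to the total geodesic curvature of the faces `F'` of infinite curvature is at least
`2Φ(e)` in the limit. -/
theorem exists_tendsto_le_edge_sum {α : Type*} {l : Filter α} (D : CellularDecomposition S V E F)
    {Φ : E → ℝ} (hΦ : ∀ e, Φ e ∈ Ioo 0 (Real.pi / 2)) {k : α → F → ℝ} (hk : ∀ᶠ x in l, ∀ f, 0 ≤ k x f)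
    {F' : Finset F} (hF' : ∀ f ∈ F', Tendsto (fun x => k x f) l atTop)
    (hF'' : ∀ f ∉ F', ∃ β, Tendsto (fun x => k x f) l (𝓝 β)) [DecidableEq F] (e : E) :
    ∃ g : α → ℝ, (∀ᶠ x in l, g x ≤
        (if D.face (e, true) ∈ F' then sideTerm D Φ (k x) (e, true) else 0) +
          if D.face (e, false) ∈ F' then sideTerm D Φ (k x) (e, false) else 0) ∧
      Tendsto g l (𝓝 (if D.face (e, true) ∈ F' ∨ D.face (e, false) ∈ F' then 2 * Φ e else 0)) := by
  have hs := sin_pos_of_mem_Ioo_pi_div_two (hΦ e)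
  have hc := cos_pos_of_mem_Ioo_pi_div_two (hΦ e)
  have hone : ∀ b : Bool, D.face (e, b) ∈ F' → D.face (e, !b) ∉ F' →
      ∃ g : α → ℝ, (∀ᶠ x in l, g x ≤ sideTerm D Φ (k x) (e, b)) ∧ Tendsto g l (𝓝 (2 * Φ e)) := by
    intro b h₁ h₂
    obtain ⟨β, hβ⟩ := hF'' _ h₂
    refine ⟨_, ?_, tendsto_euclidean_sideCurvature (hΦ e) (hF' _ h₁) hβ⟩
    filter_upwards [hk, (hF' _ h₁).eventually_gt_atTop 0] with x hx hx'
    exact le_sideCurvatureFormula hs hc hx' (hx _)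
  by_cases h₁ : D.face (e, true) ∈ F' <;> by_cases h₂ : D.face (e, false) ∈ F'
  · simp only [h₁, h₂, if_true, or_self]
    -- Both curvatures are infinite, at unrelated rates, and the two faces may coincide; the minimum
    -- of the prefactors still tends to `1`.
    refine ⟨fun x => min (k x (D.face (e, true)) / √(1 + k x (D.face (e, true)) ^ 2))
      (k x (D.face (e, false)) / √(1 + k x (D.face (e, false)) ^ 2)) * (2 * Φ e), ?_, ?_⟩
    · filter_upwards [(hF' _ h₁).eventually_gt_atTop 0, (hF' _ h₂).eventually_gt_atTop 0]
        with x hx hx'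
      exact le_sideCurvatureFormula_add (hΦ e) hx hx'
    · have := ((tendsto_div_sqrt_one_add_sq_atTop.comp (hF' _ h₁)).min
        (tendsto_div_sqrt_one_add_sq_atTop.comp (hF' _ h₂))).mul_const (2 * Φ e)
      simpa only [min_self, one_mul, Function.comp_apply] using this
  · simpa only [h₁, h₂, if_true, if_false, true_or, add_zero] using hone true h₁ h₂
  · simpa only [h₁, h₂, if_true, if_false, or_true, zero_add] using hone false h₂ h₁
  · simp only [h₁, h₂, if_false, or_self, add_zero]
    exact ⟨fun _ => 0, by simp, tendsto_const_nhds⟩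

/-- If `x` does not tend to infinity, the ultrafilter decides for some bound `x < c`, and `[ε, c]`
is compact. -/
theorem tendsto_atTop_or_nhds_of_ultrafilter {α : Type*} (U : Ultrafilter α) {x : α → ℝ} {ε : ℝ}
    (hx : ∀ᶠ a in U, ε ≤ x a) : Tendsto x U atTop ∨ ∃ β, Tendsto x U (𝓝 β) := by
  rw [or_iff_not_imp_left, tendsto_atTop]
  intro h
  obtain ⟨c, hc⟩ := not_forall.1 h
  have hIcc : ∀ᶠ a in U, x a ∈ Icc ε c := by
    filter_upwards [hx, U.eventually_not.2 hc] with a h₁ h₂ using ⟨h₁, (not_le.1 h₂).le⟩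
  obtain ⟨β, _, hβ⟩ := isCompact_Icc.ultrafilter_le_nhds' (U.map x) hIcc
  exact ⟨β, hβ⟩

theorem isBounded_subsolutions [Fintype E] [Fintype F] (D : CellularDecomposition S V E F)
    {Φ : E → ℝ} (hΦ : ∀ e, Φ e ∈ Ioo 0 (Real.pi / 2)) {I : Finset F} {Lhat : F → ℝ}
    (hL : Lhat ∈ prescribable D Φ I) {ε : ℝ} (hε : 0 < ε) :
    Bornology.IsBounded
      {k : I → ℝ | (∀ i, ε ≤ k i) ∧ ∀ i, reducedCurvature D Φ I k i ≤ Lhat i} := by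
  classical
  set A := {k : I → ℝ | (∀ i, ε ≤ k i) ∧ ∀ i, reducedCurvature D Φ I k i ≤ Lhat i} with hA
  by_contra hunb
  -- Unboundedness yields an ultrafilter of subsolutions escaping to infinity, along which every
  -- coordinate has a finite limit or tends to `+∞`.
  have hne : (Bornology.cobounded (I → ℝ) ⊓ 𝓟 A).NeBot := by
    rw [neBot_iff, Ne, ← disjoint_iff, disjoint_principal_right]
    exact hunb
  set U := Ultrafilter.of (Bornology.cobounded (I → ℝ) ⊓ 𝓟 A)
  have hUle : (U : Filter (I → ℝ)) ≤ Bornology.cobounded (I → ℝ) ⊓ 𝓟 A := Ultrafilter.of_le _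
  have hUA : ∀ᶠ k in (U : Filter (I → ℝ)), k ∈ A := (hUle.trans inf_le_right) (mem_principal_self A)
  have hdich : ∀ f : F, Tendsto (fun k => extendZero I k f) U atTop ∨
      ∃ β, Tendsto (fun k => extendZero I k f) U (𝓝 β) := fun f =>
    tendsto_atTop_or_nhds_of_ultrafilter U (ε := 0) (by
      filter_upwards [hUA] with k hk
      exact extendZero_nonneg (fun i => hε.trans_le (hk.1 i)) f)
  set F' : Finset F := {f | Tendsto (fun k => extendZero I k f) U atTop} with hF'
  have hF'I : F' ⊆ I := by
    intro f hf
    by_contra hfI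
    have h := (Finset.mem_filter.1 hf).2
    simp only [extendZero_of_notMem _ hfI] at h
    exact not_tendsto_const_atTop _ _ h
  -- If every coordinate had a finite limit, the ultrafilter would converge, contrary to its escape
  -- to infinity.
  have hF'ne : F'.Nonempty := by
    by_contra hemp
    rw [Finset.not_nonempty_iff_eq_empty] at hemp
    have hlim : ∀ i : I, ∃ β, Tendsto (fun k : I → ℝ => k i) U (𝓝 β) := by
      intro i
      rcases hdich i with h | h
      · have : (i : F) ∈ F' := Finset.mem_filter.2 ⟨Finset.mem_univ _, h⟩
        simp [hemp] at this
      · simpa only [extendZero_coe] using h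
    choose β hβ using hlim
    have hU : (U : Filter (I → ℝ)) ≤ 𝓝 β := tendsto_pi_nhds.2 hβ
    exact U.neBot.ne (le_bot_iff.1 (Metric.disjoint_nhds_cobounded β hU
      (hUle.trans inf_le_left)))
  choose g hg hglim using exists_tendsto_le_edge_sum D hΦ (l := (U : Filter (I → ℝ)))
    (k := fun k => extendZero I k) (by
      filter_upwards [hUA] with k hk using extendZero_nonneg fun i => hε.trans_le (hk.1 i))
    (F' := F') (fun f hf => (Finset.mem_filter.1 hf).2)
    (fun f hf => (hdich f).resolve_left fun h => hf (Finset.mem_filter.2 ⟨Finset.mem_univ _, h⟩))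
  have hsum := tendsto_finsetSum Finset.univ fun e _ => hglim e
  have hle : ∀ᶠ k in (U : Filter (I → ℝ)), ∑ e, g e k ≤ ∑ f ∈ F', Lhat f := by
    filter_upwards [hUA, eventually_all.2 hg] with k hk hgk
    calc ∑ e, g e k ≤ _ := Finset.sum_le_sum fun e _ => hgk e
      _ = ∑ f ∈ F', totalCurvatureFormula D Φ (extendZero I k) f :=
          (sum_totalCurvatureFormula D Φ _ F').symm
      _ ≤ ∑ f ∈ F', Lhat f := Finset.sum_le_sum fun f hf => hk.2 ⟨f, hF'I hf⟩
  -- In the limit `2 ∑ Φ(e) ≤ ∑ L̂_f` over `F'`, which the strict inequality in `prescribable`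
  -- forbids.
  have hlimit := le_of_tendsto hsum hle
  have hedges : ∑ e, (if D.face (e, true) ∈ F' ∨ D.face (e, false) ∈ F' then 2 * Φ e else 0) =
      2 * ∑ e ∈ D.edgesOf F', Φ e := by
    rw [Finset.mul_sum, ← Finset.sum_filter]
    refine Finset.sum_congr ?_ fun _ _ => rfl
    ext e
    simp [CellularDecomposition.edgesOf, or_comm]
  rw [hedges] at hlimit
  exact absurd (hL.2 F' hF'I hF'ne) (not_lt.2 hlimit)

end

/-! ### Proof of the theorem -/

theorem theorem1p8 {S V E F : Type*} [TopologicalSpace S] [T2Space S] [CompactSpace S]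
    [ChartedSpace (EuclideanSpace ℝ (Fin 2)) S] [Fintype V] [Fintype E] [Fintype F]
    (D : CellularDecomposition S V E F)
    (Φ : E → ℝ) (hΦ : ∀ e, Φ e ∈ Set.Ioo 0 (Real.pi / 2))
    (I : Finset F) (hI : I.Nonempty) (hI' : I ≠ Finset.univ)
    (Lhat : F → ℝ) (hL : Lhat ∈ prescribable D Φ I) :
    ∃ khat : F → ℝ,
      (IsDegeneratedMetric khat ∧ totalCurvature D Φ khat = Lhat) ∧
      (∀ k : F → ℝ, IsDegeneratedMetric k → totalCurvature D Φ k = Lhat → k = khat) ∧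
      khat ∈ positiveOn I ∧
      ∀ k₀ : I → ℝ, (∀ i, 0 < k₀ i) →
        ∃ k : ℝ → I → ℝ,
          (k 0 = k₀ ∧ IsFlowSolution D Φ I Lhat (Set.Ici 0) k) ∧
          (∀ T > 0, ∀ k' : ℝ → I → ℝ, k' 0 = k₀ →
            IsFlowSolution D Φ I Lhat (Set.Ico 0 T) k' → Set.EqOn k' k (Set.Ico 0 T)) ∧
          Filter.Tendsto (fun t => extendZero I (k t)) Filter.atTop (nhds khat) := by
  have hcoop := isScalingCooperative_reducedCurvature D hΦ I
  obtain ⟨κ, hκ, hκL⟩ := hcoop.exists_eq (Lhat := fun i : I => Lhat i) (fun i => hL.1.1 i i.2)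
    (fun ε hε => isBounded_subsolutions D hΦ hL hε)
  refine ⟨extendZero I κ, ⟨⟨extendZero_nonneg hκ, ?_⟩, ?_⟩, ?_, extendZero_mem_positiveOn hκ, ?_⟩
  · obtain ⟨f, hf⟩ : ∃ f, f ∉ I := by
      by_contra! h
      exact hI' (Finset.eq_univ_iff_forall.2 h)
    exact ⟨f, extendZero_of_notMem κ hf⟩
  · rw [totalCurvature_eq_formula D hΦ (extendZero_nonneg hκ)]
    funext f
    by_cases hf : f ∈ I
    · exact congrFun hκL ⟨f, hf⟩
    · rw [totalCurvatureFormula_eq_zero D Φ (extendZero_of_notMem κ hf), hL.1.2 f hf]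
  · intro k hk hkL
    rw [totalCurvature_eq_formula D hΦ hk.1] at hkL
    -- Total curvature vanishes exactly where `k` does, so a competitor is supported on `I` and the
    -- reduced uniqueness applies.
    have hpos : ∀ i : I, 0 < k i := fun i => (hk.1 i).lt_of_ne fun h => by
      have h₁ := totalCurvatureFormula_eq_zero D Φ h.symm
      rw [hkL] at h₁
      exact (hL.1.1 i i.2).ne' h₁
    have hext : extendZero I (fun i => k i) = k := by
      funext f
      by_cases hf : f ∈ I
      · exact extendZero_of_mem _ hf
      · rw [extendZero_of_notMem _ hf]
        by_contra h
        have h₁ := totalCurvatureFormula_pos D Φ ((hk.1 f).lt_of_ne h)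
        rw [hkL, hL.1.2 f hf] at h₁
        exact lt_irrefl _ h₁
    rw [← hext, hcoop.eq_of_eq hpos hκ]
    rw [hκL]
    funext i
    rw [reducedCurvature, hext, hkL]
  · intro k₀ hk₀
    obtain ⟨k, ⟨hk0, hk⟩, huniq, hlim⟩ := hcoop.exists_flow hκ hk₀
    have hκi : ∀ i : I, reducedCurvature D Φ I κ i = Lhat i := fun i => congrFun hκL i
    refine ⟨k, ⟨hk0, fun t ht i => ⟨(hk t ht i).1, ?_⟩⟩, fun T hT k' hk'0 hk' => ?_, ?_⟩
    · rw [totalCurvature_extendZero D hΦ fun j => (hk t ht j).1, ← hκi]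
      exact (hk t ht i).2
    · refine huniq T hT k' hk'0 fun t ht i => ⟨(hk' t ht i).1, ?_⟩
      rw [← totalCurvature_extendZero D hΦ fun j => (hk' t ht j).1, hκi]
      exact (hk' t ht i).2
    · exact tendsto_pi_nhds.2 fun f =>
        ((contDiff_extendZero_apply (n := 0) I f).continuous.tendsto κ).comp hlim
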